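/- A \emph{zero-error channel} $\mathcal W$ with nonempty finite input alphabet $\mathcal X$ and output set $\mathcal Y$ assigns to every $x\in\mathcal X$ a nonempty set $\mathcal W(x)\subseteq\mathcal Y$ of possible outputs. A channel $\mathcal V$ \emph{implements} $\mathcal W$ if there are an encoding function $e$ of the sender (from inputs of $\mathcal W$ to inputs of $\mathcal V$) and a decoding function $d$ of the receiver (from outputs of $\mathcal V$ to outputs of $\mathcal W$) such that $d(y)\in\mathcal W(x)$ for every $x$ and every $y\in\mathcal V(e(x))$. A channel $\mathcal V$ \emph{achieves} $\mathcal W$, written $\mathcal V\to\mathcal W$, if for some $k\in\mathbb N$ the channel consisting of $k$ independent invocations of $\mathcal V$ implements $\mathcal W$. For an integer $a\ge 1$, $\mathrm{List}_a$ is the channel with input alphabet $\{1,\dots,a+1\}$ whose possible outputs on input $x$ are the $a$-element subsets of $\{1,\dots,a+1\}$ that contain $x$; $\mathrm{List}_\infty$ is the trivial channel, with one input and one output. The \emph{ambiguity} $A(\mathcal W)$ is the unique $a\in\{1,2,\dots\}\cup\{\infty\}$ with $\mathcal W\to\mathrm{List}_a$ and $\mathrm{List}_a\to\mathcal W$. Let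 $\mathcal W_1,\dots,\mathcal W_n$ be zero-error channels with nonempty finite input alphabets $\mathcal X_i$ and output sets $\mathcal Y_i$, and let $t\ge 0$ be an integer. Their parallel concatenation $\mathcal W_p$, when up to $t$ of them may be malicious, is the following resource. Using it for $k$ rounds means using the channel $\mathcal W_p^{(k)}$ with input alphabet $(\prod_i\mathcal X_i)^k$ and output set $(\prod_i\mathcal Y_i)^k$, for which $(y^1,\dots,y^k)$ is a possible output on input $(x^1,\dots,x^k)$ if and only if there is a set $M\subseteq\{1,\dots,n\}$ (the malicious channels, the same in all rounds) with $|M|\le t$ such that $y^j_i\in\mathcal W_i(x^j_i)$ for all $i\notin M$ and all $j$. The ambiguity $A(\mathcal W_p)$ is the $a\in\{1,2,\dots\}\cup\{\infty\}$ such that $\mathcal W_p^{(k)}$ implements $\mathrm{List}_a$ for some $k\in\mathbb N$, and $\mathrm{List}_a\to\mathcal W_p^{(k)}$ for every $k\in\mathbb N$. \textbf{Theorem.} There is exactly one such $a$, namely \[ A(\mathcal W_p)\;=\;\min_{\substack{G\subseteq\{1,\dots,n\}\\ |G|>t}}\left\lfloor\frac{\sum_{i\in G}A(\mathcal W_i)}{|G|-t}\right\rfloor,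 \] where a sum with an infinite term, and its quotient, are $\infty$, and the minimum over no sets (the case $t\ge n$) is $\infty$. -/

import Mathlib

open Finset
open scoped ENNReal

/-- A zero-error `(X, Y)`-channel: every input symbol has a nonempty set of possible outputs. -/
structure ZeroErrorChannel (X Y : Type*) where
  /-- The set of valid output symbols for an input symbol. -/
  out : X → Set Y
  out_nonempty : ∀ x, (out x).Nonempty

namespace ZeroErrorChannel

/-- `k` independent (memoryless) invocations of a channel. -/
def uses {X Y : Type*} (W : ZeroErrorChannel X Y) (k : ℕ) :
    ZeroErrorChannel (Fin k → X) (Fin k → Y) where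
  out x := {y | ∀ j, y j ∈ W.out (x j)}
  out_nonempty x := ⟨fun j => (W.out_nonempty (x j)).some,
    fun j => (W.out_nonempty (x j)).some_mem⟩

/-- `V.Implements W`: a single invocation of `V`, together with an encoding function of the sender
and a decoding function of the receiver, always yields an output that is valid for `W`. -/
def Implements {X₀ Y₀ X₁ Y₁ : Type*} (V : ZeroErrorChannel X₀ Y₀) (W : ZeroErrorChannel X₁ Y₁) :
    Prop :=
  ∃ (enc : X₁ → X₀) (dec : Y₀ → Y₁), ∀ x, ∀ y ∈ V.out (enc x), dec y ∈ W.out x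

/-- `V.Achieves W` (`V → W`): there is a protocol (without feedback) in which the sender transmits
a word of some fixed finite length over `V` and the receiver computes from the received word an
output that is valid for `W`, for every input and for all possible outputs of the invocations. -/
def Achieves {X₀ Y₀ X₁ Y₁ : Type*} (V : ZeroErrorChannel X₀ Y₀) (W : ZeroErrorChannel X₁ Y₁) :
    Prop :=
  ∃ k : ℕ, (V.uses k).Implements W

/-- The `(a, d)`-List-channel: the input is one of `d` symbols, the output is a set of exactly `a`
symbols that contains the input. -/
def list (a d : ℕ) (ha : 0 < a) (had : a < d) :
    ZeroErrorChannel (Fin d) {s : Finset (Fin d) // s.card = a} where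
  out x := {s | x ∈ s.1}
  out_nonempty x := by
    obtain ⟨s, hs, hc⟩ := Finset.exists_superset_card_eq (s := {x}) (n := a)
      (by simpa using Nat.succ_le_of_lt ha) (by simpa using had.le)
    exact ⟨⟨s, hc⟩, hs (by simp)⟩

/-- The channel `List_a = List_{a,a+1}`, for `1 ≤ a < ∞`. -/
abbrev listSucc (a : ℕ) (ha : 0 < a) :
    ZeroErrorChannel (Fin (a + 1)) {s : Finset (Fin (a + 1)) // s.card = a} :=
  list a (a + 1) ha a.lt_succ_self

/-- The channel `List_∞`, over which no communication is possible. -/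
def listTop : ZeroErrorChannel Unit Unit where
  out _ := Set.univ
  out_nonempty _ := ⟨(), trivial⟩

/-- `W.IsAmbiguity a`: `W → List_a` and `List_a → W`, for `a ∈ {1, 2, …} ∪ {∞}`. -/
def IsAmbiguity {X Y : Type*} (W : ZeroErrorChannel X Y) (a : ℕ∞) : Prop :=
  (a = ⊤ ∧ W.Achieves listTop ∧ listTop.Achieves W) ∨
  ∃ (m : ℕ) (hm : 0 < m), a = m ∧ W.Achieves (listSucc m hm) ∧ (listSucc m hm).Achieves W

/-! ### Every channel with finite nonempty input alphabet has exactly one ambiguity -/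

/-- All `a`-tuples of inputs of `W` are adjacent, i.e. have a common possible output. -/
def Adjacent {X Y : Type*} (W : ZeroErrorChannel X Y) (a : ℕ) : Prop :=
  ∀ f : Fin a → X, ∃ y, ∀ i, y ∈ W.out (f i)

section wellDefined

variable {X Y X₀ Y₀ X₁ Y₁ : Type*}

theorem Adjacent.mono {W : ZeroErrorChannel X Y} [Nonempty X] {a b : ℕ} (h : W.Adjacent b)
    (hab : a ≤ b) : W.Adjacent a := by
  intro f
  obtain ⟨y, hy⟩ := h fun i => if hi : i.1 < a then f ⟨i, hi⟩ else Classical.arbitrary X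
  refine ⟨y, fun i => ?_⟩
  have := hy ⟨i, i.2.trans_le hab⟩
  simpa using this

theorem Adjacent.of_achieves {V : ZeroErrorChannel X₀ Y₀} {W : ZeroErrorChannel X₁ Y₁} {a : ℕ}
    (h : V.Adjacent a) (hVW : V.Achieves W) : W.Adjacent a := by
  obtain ⟨k, enc, dec, hed⟩ := hVW
  intro f
  choose y hy using fun j : Fin k => h fun i => enc (f i) j
  exact ⟨dec y, fun i => hed _ _ fun j => hy j i⟩

theorem not_adjacent_list (a d : ℕ) (ha : 0 < a) (had : a < d) :
    ¬ (list a d ha had).Adjacent (a + 1) := by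
  intro h
  obtain ⟨s, hs⟩ := h fun i => Fin.castLE had i
  have : (univ.image fun i : Fin (a + 1) => Fin.castLE had i) ⊆ s.1 := by
    intro x hx
    obtain ⟨i, -, rfl⟩ := mem_image.1 hx
    exact hs i
  have h2 := card_le_card this
  rw [card_image_of_injective _ (Fin.castLE_injective had), s.2, card_univ, Fintype.card_fin] at h2
  omega

theorem adjacent_list (a d : ℕ) (ha : 0 < a) (had : a < d) : (list a d ha had).Adjacent a := by
  intro f
  obtain ⟨s, hs, hc⟩ := Finset.exists_superset_card_eq (s := univ.image f) (n := a)
    (by simpa using card_image_le (s := univ) (f := f)) (by simpa using had.le)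
  exact ⟨⟨s, hc⟩, fun i => hs (by simp)⟩

theorem achieves_list {W : ZeroErrorChannel X Y} {a d : ℕ} (ha : 0 < a) (had : a < d)
    (h : ¬ W.Adjacent (a + 1)) : W.Achieves (list a d ha had) := by
  classical
  unfold Adjacent at h
  push Not at h
  obtain ⟨f, hf⟩ := h
  let e := Fintype.equivFin (Fin d → Fin (a + 1))
  have key : ∀ y : Fin (Fintype.card (Fin d → Fin (a + 1))) → Y,
      ∃ s : {s : Finset (Fin d) // s.card = a},
        (univ.filter fun x : Fin d => ∀ j, y j ∈ W.out (f (e.symm j x))) ⊆ s.1 := by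
    intro y
    set T := univ.filter fun x : Fin d => ∀ j, y j ∈ W.out (f (e.symm j x)) with hT
    have hc : T.card ≤ a := by
      by_contra hlt
      obtain ⟨U, hU, hUc⟩ := exists_subset_card_eq (s := T) (n := a + 1) (by omega)
      let u := U.equivFinOfCardEq hUc
      let g : Fin d → Fin (a + 1) := fun x => if hx : x ∈ U then u ⟨x, hx⟩ else 0
      obtain ⟨i, hi⟩ := hf (y (e g))
      apply hi
      have h1 : (u.symm i).1 ∈ T := hU (u.symm i).2
      have h2 := (mem_filter.1 h1).2 (e g)
      simpa [g] using h2
    obtain ⟨s, hs, hsc⟩ := Finset.exists_superset_card_eq hc (by simpa using had.le)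
    exact ⟨⟨s, hsc⟩, hs⟩
  choose dec hdec using key
  exact ⟨_, fun x j => f (e.symm j x), dec,
    fun x y hy => hdec y (mem_filter.2 ⟨mem_univ x, hy⟩)⟩

theorem Achieves.trans_implements {V : ZeroErrorChannel X₀ Y₀} {W : ZeroErrorChannel X₁ Y₁}
    {U : ZeroErrorChannel X Y} (h : V.Achieves W) (h' : W.Implements U) : V.Achieves U := by
  obtain ⟨k, enc, dec, hed⟩ := h
  obtain ⟨enc', dec', hed'⟩ := h'
  exact ⟨k, enc ∘ enc', dec' ∘ dec, fun x y hy => hed' _ _ (hed _ _ hy)⟩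

theorem listSucc_achieves [Finite X] [Nonempty X] {W : ZeroErrorChannel X Y} {a : ℕ} (ha : 0 < a)
    (h : W.Adjacent a) : (listSucc a ha).Achieves W := by
  classical
  have := Fintype.ofFinite X
  have had : a < Fintype.card X + a + 1 := by omega
  refine (achieves_list ha had (not_adjacent_list _ _ _ _)).trans_implements ?_
  let c : X → Fin (Fintype.card X + a + 1) := fun x => Fin.castLE (by omega) (Fintype.equivFin X x)
  have hc : Function.Injective c :=
    (Fin.castLE_injective _).comp (Fintype.equivFin X).injective
  choose D hD using h
  refine ⟨c, fun s => D fun i => Function.invFun c ((s.1.equivFinOfCardEq s.2).symm i).1,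
    fun x s hs => ?_⟩
  have := hD (fun i => Function.invFun c ((s.1.equivFinOfCardEq s.2).symm i).1)
    (s.1.equivFinOfCardEq s.2 ⟨c x, hs⟩)
  simpa [Function.leftInverse_invFun hc x] using this

theorem achieves_listTop (W : ZeroErrorChannel X Y) : W.Achieves listTop :=
  ⟨0, fun _ => Fin.elim0, fun _ => (), fun _ _ _ => trivial⟩

theorem listTop_achieves [Finite X] {W : ZeroErrorChannel X Y} (h : ∀ a, W.Adjacent a) :
    listTop.Achieves W := by
  have := Fintype.ofFinite X
  obtain ⟨y, hy⟩ := h _ (Fintype.equivFin X).symm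
  exact ⟨0, fun _ => Fin.elim0, fun _ => y, fun x _ _ => by simpa using hy (Fintype.equivFin X x)⟩

theorem IsAmbiguity.adjacent {W : ZeroErrorChannel X Y} {a : ℕ∞} [Nonempty X]
    (h : W.IsAmbiguity a) (m : ℕ) : W.Adjacent m ↔ (m : ℕ∞) ≤ a := by
  obtain ⟨rfl, -, h⟩ | ⟨n, hn, rfl, h1, h2⟩ := h
  · exact ⟨fun _ => le_top, fun _ => Adjacent.of_achieves (fun _ => ⟨(), fun _ => Set.mem_univ _⟩) h⟩
  · rw [Nat.cast_le]
    refine ⟨fun h => ?_, fun h => ((adjacent_list _ _ _ _).of_achieves h2).mono h⟩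
    by_contra hlt
    exact not_adjacent_list _ _ _ _ ((h.mono (by omega : n + 1 ≤ m)).of_achieves h1)

theorem existsUnique_isAmbiguity [Finite X] [Nonempty X] (W : ZeroErrorChannel X Y) :
    ∃! a, W.IsAmbiguity a := by
  classical
  refine existsUnique_of_exists_of_unique ?_ fun a b ha hb => ?_
  · by_cases h : ∀ a, W.Adjacent a
    · exact ⟨⊤, .inl ⟨rfl, achieves_listTop W, listTop_achieves h⟩⟩
    · push Not at h
      have h1 : W.Adjacent 1 := fun f => by
        obtain ⟨y, hy⟩ := W.out_nonempty (f 0)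
        exact ⟨y, fun i => by rwa [Subsingleton.elim i 0]⟩
      have hm : 1 < Nat.find h := by
        by_contra hlt
        exact Nat.find_spec h (h1.mono (by omega))
      obtain ⟨n, hn⟩ : ∃ n, Nat.find h = n + 1 := ⟨Nat.find h - 1, by omega⟩
      have h2 : ¬ W.Adjacent (n + 1) := hn ▸ Nat.find_spec h
      have h3 : W.Adjacent n := not_not.1 (Nat.find_min h (by omega))
      exact ⟨n, .inr ⟨n, by omega, rfl, achieves_list _ _ h2, listSucc_achieves _ h3⟩⟩
  · exact ENat.eq_of_forall_natCast_le_iff fun m => (ha.adjacent m).symm.trans (hb.adjacent m)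

end wellDefined

/-- The ambiguity `A(W)`: the unique `a ∈ {1, 2, …} ∪ {∞}` with `W → List_a` and `List_a → W`. -/
noncomputable def ambiguity {X Y : Type*} [Finite X] [Nonempty X] (W : ZeroErrorChannel X Y) : ℕ∞ :=
  (existsUnique_isAmbiguity W).choose

theorem isAmbiguity_ambiguity {X Y : Type*} [Finite X] [Nonempty X] (W : ZeroErrorChannel X Y) :
    W.IsAmbiguity W.ambiguity :=
  (existsUnique_isAmbiguity W).choose_spec.1

/-! ### Resources that are used for several rounds -/

/-- The ambiguity of a communication resource whose use for `k` rounds is the channel `R k`: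
`List_a` is implemented by some number of rounds of the resource, and `List_a` achieves any number
of rounds of the resource. -/
def IsAmbiguityOfRounds {X Y : Type*} (R : ∀ k : ℕ, ZeroErrorChannel (Fin k → X) (Fin k → Y))
    (a : ℕ∞) : Prop :=
  (a = ⊤ ∧ (∃ k, (R k).Implements listTop) ∧ ∀ k, listTop.Achieves (R k)) ∨
  ∃ (m : ℕ) (hm : 0 < m), a = m ∧ (∃ k, (R k).Implements (listSucc m hm)) ∧
    ∀ k, (listSucc m hm).Achieves (R k)

/-- For the memoryless use of a single channel this is the ambiguity of the channel. -/
theorem isAmbiguityOfRounds_uses {X Y : Type*} [Finite X] [Nonempty X] (W : ZeroErrorChannel X Y)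
    (a : ℕ∞) : IsAmbiguityOfRounds W.uses a ↔ W.IsAmbiguity a := by
  have adj : ∀ m k, W.Adjacent m → (W.uses k).Adjacent m := fun m k h f => by
    choose y hy using fun j => h fun i => f i j
    exact ⟨y, fun i j => hy j i⟩
  have one : ∀ m, (W.uses 1).Adjacent m → W.Adjacent m := fun m h f => by
    obtain ⟨y, hy⟩ := h fun i _ => f i
    exact ⟨y 0, fun i => hy i 0⟩
  constructor
  · rintro (⟨rfl, h1, h2⟩ | ⟨m, hm, rfl, h1, h2⟩)
    · refine .inl ⟨rfl, h1, listTop_achieves fun m => one m ?_⟩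
      exact Adjacent.of_achieves (fun _ => ⟨(), fun _ => Set.mem_univ _⟩) (h2 1)
    · exact .inr ⟨m, hm, rfl, h1,
        listSucc_achieves hm (one m ((adjacent_list _ _ _ _).of_achieves (h2 1)))⟩
  · intro h
    obtain ⟨rfl, h1, h2⟩ | ⟨m, hm, rfl, h1, h2⟩ := id h
    · exact .inl ⟨rfl, h1, fun k => listTop_achieves fun m => adj m k ((h.adjacent m).2 le_top)⟩
    · exact .inr ⟨m, hm, rfl, h1, fun k => listSucc_achieves hm (adj m k ((h.adjacent m).2 le_rfl))⟩

/-! ### Parallel concatenation -/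

/-- The parallel concatenation of `W 1, …, W n`, of which up to `t` may be malicious, used for `k`
rounds. In each round the sender gives an input to every channel and the receiver sees the outputs
of all of them. The outputs of the channels in some set `M` of at most `t` malicious channels, which
is the same in all rounds and unknown to the receiver, are arbitrary; all others behave as
specified. -/
def parallel {n : ℕ} {X Y : Fin n → Type*} (W : ∀ i, ZeroErrorChannel (X i) (Y i)) (t k : ℕ) :
    ZeroErrorChannel (Fin k → ∀ i, X i) (Fin k → ∀ i, Y i) where
  out x := {y | ∃ M : Finset (Fin n), #M ≤ t ∧ ∀ i ∉ M, ∀ j, y j i ∈ (W i).out (x j i)}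
  out_nonempty x := ⟨fun j i => ((W i).out_nonempty (x j i)).some, ∅, by simp,
    fun i _ j => ((W i).out_nonempty (x j i)).some_mem⟩

end ZeroErrorChannel

/-! The ambiguity is the largest `m`, if any, such that every `m` inputs share a possible output for
every number of rounds (`isAmbiguityOfRounds_iff`). A common output of `m` words assigns to each
word a set of at least `n - t` channels that behave honestly for it. With suitable codes, channel
`i` can be honest for at most `min (A i) m` words; conversely, it can always serve any `A i` words
at once. Double counting honest (channel, word) pairs gives the necessary condition `m * (n - t) ≤ ∑
i, min (A i) m`, and cyclic intervals show that it suffices (`parallel_adjacent_iff`). The truncated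
sum is a minimum over subsets `G`, which turns the condition into the formula
(`mul_sub_le_sum_min_iff`). -/

/-- Consecutive cyclic intervals of lengths `c i ≤ m` cover `Fin m` evenly. -/
theorem exists_finset_fin_cover {n m q : ℕ} (c : Fin n → ℕ) (hc : ∀ i, c i ≤ m)
    (h : m * q ≤ ∑ i, c i) :
    ∃ B : Fin n → Finset (Fin m), (∀ i, #(B i) ≤ c i) ∧
      ∀ j, q ≤ #(univ.filter fun i => j ∈ B i) := by
  classical
  let e := finSigmaFinEquiv (n := c)
  -- Intervals of lengths `c i` are laid end to end from 0 and reduced mod `m`.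
  refine ⟨fun i => univ.filter fun j => ∃ k : Fin (c i), (e ⟨i, k⟩).1 % m = j, fun i => ?_,
    fun j => ?_⟩
  · rw [← card_image_of_injective _ Fin.val_injective]
    calc _ ≤ #(univ.image fun k : Fin (c i) => (e ⟨i, k⟩).1 % m) := card_le_card fun x hx => by
          obtain ⟨j, hj, rfl⟩ := mem_image.1 hx
          obtain ⟨k, hk⟩ := (mem_filter.1 hj).2
          exact mem_image.2 ⟨k, mem_univ _, hk⟩
      _ ≤ c i := card_image_le.trans (by simp)
  -- The `q` points `j + m * r` all reduce to `j` and lie inside the laid-out range.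
  · have hlt (r : Fin q) : j.1 + m * r.1 < ∑ i, c i := by
      have : m * (r.1 + 1) ≤ m * q := Nat.mul_le_mul_left _ r.2
      have := j.2
      rw [mul_add] at *
      omega
    let p (r : Fin q) := e.symm ⟨j.1 + m * r.1, hlt r⟩
    obtain ⟨S, hp⟩ : ∃ S : Fin n → ℕ, ∀ r, S (p r).1 + (p r).2.1 = j.1 + m * r.1 := by
      refine ⟨fun i => ∑ l : Fin i.1, c (Fin.castLE i.2.le l), fun r => ?_⟩
      rw [← finSigmaFinEquiv_apply]
      exact congrArg Fin.val (e.apply_symm_apply _)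
    -- Two such points differ by at least `m`, so no interval of length at most `m` contains both.
    have hinj : Function.Injective fun r => (p r).1 := by
      have key (r s : Fin q) (hrs : (p r).1 = (p s).1) : ¬ r.1 < s.1 := by
        intro hlt'
        have h1 := hp r
        have h2 := hp s
        have h3 := (p s).2.2.trans_le (hc _)
        have h5 := congrArg S hrs
        have h4 : m * (r.1 + 1) ≤ m * s.1 := Nat.mul_le_mul_left _ hlt'
        rw [mul_add] at h4
        omega
      intro r s hrs
      have h1 := key r s hrs
      have h2 := key s r hrs.symm
      exact Fin.ext (by omega)
    rw [← Fintype.card_fin q, ← card_univ, ← card_image_of_injective _ hinj]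
    refine card_le_card fun i hi => ?_
    obtain ⟨r, -, rfl⟩ := mem_image.1 hi
    refine mem_filter.2 ⟨mem_univ _, mem_filter.2 ⟨mem_univ _, (p r).2, ?_⟩⟩
    have : e ⟨(p r).1, (p r).2⟩ = ⟨j.1 + m * r.1, hlt r⟩ := e.apply_symm_apply _
    rw [this]
    simp [Nat.mod_eq_of_lt j.2]

/-! ### Arithmetic of the formula -/

theorem ENat.natCast_le_floor_div_iff {m d : ℕ} {S : ℕ∞} (hd : d ≠ 0) :
    (m : ℕ∞) ≤ ⌊(S : ℝ≥0∞) / (d : ℝ≥0∞)⌋ₑ ↔ ((m * d : ℕ) : ℕ∞) ≤ S := by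
  rw [ENat.le_floor, ENat.toENNReal_coe, ENNReal.le_div_iff_mul_le (by simp [hd]) (by simp),
    ← ENat.toENNReal_le]
  simp

/-- Each index outside `G` contributes at most `m` to the truncated sum, and the extremal `G` is the
set where `A i < m`. If that set has at most `t` elements, the terms equal to `m` already suffice.
-/
theorem mul_sub_le_sum_min_iff {n m t : ℕ} (A : Fin n → ℕ∞) :
    ((m * (n - t) : ℕ) : ℕ∞) ≤ ∑ i, min (A i) m ↔
      ∀ G : Finset (Fin n), t < #G → ((m * (#G - t) : ℕ) : ℕ∞) ≤ ∑ i ∈ G, A i := by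
  classical
  constructor
  · intro h G hG
    rw [← sum_add_sum_compl G] at h
    have h1 : ∑ i ∈ G, min (A i) m ≤ ∑ i ∈ G, A i := sum_le_sum fun i _ => min_le_left _ _
    have h2 : ∑ i ∈ Gᶜ, min (A i) m ≤ ((n - #G) * m : ℕ) := by
      refine (sum_le_sum fun i _ => min_le_right _ _).trans ?_
      simp [card_compl]
    have hGn : #G ≤ n := by simpa using card_le_univ G
    have h3 : m * (n - t) = m * (#G - t) + (n - #G) * m := by
      rw [mul_comm _ m, ← mul_add]
      congr 1
      omega
    have h4 := h.trans (add_le_add h1 h2)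
    rw [h3, Nat.cast_add] at h4
    exact (ENat.add_le_add_iff_right (ENat.natCast_ne_top _)).1 h4
  · intro h
    let G := univ.filter fun i => A i < m
    have hGn : #G ≤ n := by simpa using card_le_univ G
    have h1 : ∑ i ∈ G, min (A i) m = ∑ i ∈ G, A i :=
      sum_congr rfl fun i hi => min_eq_left (mem_filter.1 hi).2.le
    have h2 : ∑ i ∈ Gᶜ, min (A i) m = (((n - #G) * m : ℕ) : ℕ∞) := by
      rw [sum_congr rfl fun i hi => min_eq_right (a := A i) (b := m)
        (by simpa [G] using hi)]
      simp [card_compl]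
    rw [← sum_add_sum_compl G, h1, h2]
    by_cases hG : t < #G
    · refine le_trans ?_ (add_le_add (h G hG) le_rfl)
      rw [← Nat.cast_add, Nat.cast_le, mul_comm _ m, ← mul_add]
      exact Nat.mul_le_mul_left _ (by omega)
    · refine le_trans ?_ le_add_self
      rw [Nat.cast_le, mul_comm _ m]
      exact Nat.mul_le_mul_left _ (by omega)

/-! ### Adjacency and ambiguity of multi-round resources -/

namespace ZeroErrorChannel

variable {X Y X₀ Y₀ X₁ Y₁ : Type*}

theorem Adjacent.exists_common_output [Nonempty X] {W : ZeroErrorChannel X Y} {a : ℕ}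
    (h : W.Adjacent a) {ι : Type*} (B : Finset ι) (hB : #B ≤ a) (g : ι → X) :
    ∃ y, ∀ j ∈ B, y ∈ W.out (g j) := by
  obtain ⟨y, hy⟩ := h.mono hB fun i => g (B.equivFin.symm i).1
  exact ⟨y, fun j hj => by simpa using hy (B.equivFin ⟨j, hj⟩)⟩

theorem Adjacent.of_implements {V : ZeroErrorChannel X₀ Y₀} {W : ZeroErrorChannel X₁ Y₁} {a : ℕ}
    (h : V.Adjacent a) (hVW : V.Implements W) : W.Adjacent a := by
  obtain ⟨enc, dec, hed⟩ := hVW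
  intro f
  obtain ⟨y, hy⟩ := h fun i => enc (f i)
  exact ⟨dec y, fun i => hed _ _ (hy i)⟩

/-- A non-adjacent tuple is itself the code: every output excludes one of its `a + 1` words. One
invocation is enough, which matters because rounds with a fixed malicious set are not independent
invocations. -/
theorem implements_listSucc {W : ZeroErrorChannel X Y} {a : ℕ} (ha : 0 < a)
    (h : ¬ W.Adjacent (a + 1)) : W.Implements (listSucc a ha) := by
  classical
  unfold Adjacent at h
  push Not at h
  obtain ⟨f, hf⟩ := h
  have key (y : Y) : ∃ s : {s : Finset (Fin (a + 1)) // s.card = a},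
      (univ.filter fun x => y ∈ W.out (f x)) ⊆ s.1 := by
    have hlt : #(univ.filter fun x => y ∈ W.out (f x)) < #(univ : Finset (Fin (a + 1))) := by
      obtain ⟨i, hi⟩ := hf y
      exact card_lt_card (filter_ssubset.2 ⟨i, mem_univ _, hi⟩)
    rw [card_univ, Fintype.card_fin] at hlt
    obtain ⟨s, hs, hsc⟩ := Finset.exists_superset_card_eq (Nat.lt_succ_iff.1 hlt)
      (by simp : a ≤ Fintype.card (Fin (a + 1)))
    exact ⟨⟨s, hsc⟩, hs⟩
  choose dec hdec using key
  exact ⟨f, dec, fun x y hy => hdec y (mem_filter.2 ⟨mem_univ x, hy⟩)⟩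

/-- The ambiguity of a resource is the largest number `m`, if any, such that all `m`-tuples of inputs
are adjacent for every number of rounds. -/
theorem isAmbiguityOfRounds_iff [Finite X] [Nonempty X]
    {R : ∀ k : ℕ, ZeroErrorChannel (Fin k → X) (Fin k → Y)} {a : ℕ∞} :
    IsAmbiguityOfRounds R a ↔ ∀ m : ℕ, (∀ k, (R k).Adjacent m) ↔ (m : ℕ∞) ≤ a := by
  constructor
  · rintro (⟨rfl, -, h⟩ | ⟨n, hn, rfl, ⟨k, h1⟩, h2⟩) m
    · exact ⟨fun _ => le_top,
        fun _ k => Adjacent.of_achieves (fun _ => ⟨(), fun _ => Set.mem_univ _⟩) (h k)⟩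
    · rw [Nat.cast_le]
      refine ⟨fun h => ?_, fun h k => ((adjacent_list _ _ _ _).of_achieves (h2 k)).mono h⟩
      by_contra hlt
      exact not_adjacent_list _ _ _ _ (((h k).mono (by omega : n + 1 ≤ m)).of_implements h1)
  · intro h
    induction a using ENat.recTopCoe with
    | top =>
      exact .inl ⟨rfl, ⟨0, fun _ => Fin.elim0, fun _ => (), fun _ _ _ => trivial⟩,
        fun k => listTop_achieves fun m => (h m).2 le_top k⟩
    | coe m =>
      have hm : 1 ≤ m := Nat.cast_le.1 ((h 1).1 fun k f => by
        obtain ⟨y, hy⟩ := (R k).out_nonempty (f 0)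
        exact ⟨y, fun i => by rwa [Subsingleton.elim i 0]⟩)
      have hk : ¬ ∀ k, (R k).Adjacent (m + 1) := fun hk => by
        have := Nat.cast_le.1 ((h (m + 1)).1 hk)
        omega
      obtain ⟨k, hk⟩ := not_forall.1 hk
      exact .inr ⟨m, hm, rfl, ⟨k, implements_listSucc hm hk⟩,
        fun k => listSucc_achieves hm ((h m).2 le_rfl k)⟩

/-- Codes with `m` words for which every output is compatible with at most `min (A(W)) m` words. -/
theorem exists_code_card_le [Finite X] [Nonempty X] (W : ZeroErrorChannel X Y) (m : ℕ) :
    ∃ k₀, ∀ k ≥ k₀, ∃ f : Fin m → Fin k → X, ∀ y : Fin k → Y, ∀ B : Finset (Fin m),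
      (∀ j ∈ B, ∀ r, y r ∈ W.out (f j r)) → (#B : ℕ∞) ≤ min W.ambiguity m := by
  have hB (B : Finset (Fin m)) : #B ≤ m := by simpa using card_le_univ B
  obtain hm | hm := le_or_gt (m : ℕ∞) W.ambiguity
  · refine ⟨0, fun k _ => ⟨fun _ _ => Classical.arbitrary X, fun y B _ => ?_⟩⟩
    rw [min_eq_right hm, Nat.cast_le]
    exact hB B
  · obtain ⟨a, ha⟩ := ENat.ne_top_iff_exists.1 hm.ne_top
    have hadj := W.isAmbiguity_ambiguity.adjacent
    rw [← ha] at hm hadj ⊢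
    have hm' : a < m := Nat.cast_lt.1 hm
    have ha0 : 0 < a := Nat.cast_le.1 ((hadj 1).1 fun f => by
      obtain ⟨y, hy⟩ := W.out_nonempty (f 0)
      exact ⟨y, fun i => by rwa [Subsingleton.elim i 0]⟩)
    have hna : ¬ W.Adjacent (a + 1) := fun h => by
      have := Nat.cast_le.1 ((hadj (a + 1)).1 h)
      omega
    -- The decoded `a`-set contains every word compatible with the output. Padding the code beyond
    -- `k₀` lets all channels share one length.
    obtain ⟨k₀, enc, dec, hed⟩ := achieves_list ha0 hm' hna
    refine ⟨k₀, fun k hk => ⟨fun j r => if hr : r.1 < k₀ then enc j ⟨r, hr⟩ else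
      Classical.arbitrary X, fun y B hy => ?_⟩⟩
    rw [min_eq_left hm.le, Nat.cast_le, ← (dec fun r => y (Fin.castLE hk r)).2]
    refine card_le_card fun j hj => hed j _ fun r => ?_
    simpa using hy j hj (Fin.castLE hk r)

theorem parallel_adjacent_iff {n : ℕ} {X Y : Fin n → Type*} [∀ i, Finite (X i)]
    [∀ i, Nonempty (X i)] (W : ∀ i, ZeroErrorChannel (X i) (Y i)) (t m : ℕ) :
    (∀ k, (parallel W t k).Adjacent m) ↔
      ((m * (n - t) : ℕ) : ℕ∞) ≤ ∑ i, min (W i).ambiguity m := by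
  classical
  constructor
  · intro h
    choose k₀ hk₀ using fun i => exists_code_card_le (W i) m
    let k := univ.sup k₀
    choose f hf using fun i => hk₀ i k (le_sup (mem_univ i))
    obtain ⟨y, hy⟩ := h k fun j r i => f i j r
    choose M hM hMy using hy
    -- The words for which channel `i` counts as honest.
    let B (i : Fin n) : Finset (Fin m) := univ.filter fun j => i ∉ M j
    calc ((m * (n - t) : ℕ) : ℕ∞) ≤ ((∑ i, #(B i) : ℕ) : ℕ∞) := by
          rw [Nat.cast_le]
          change _ ≤ ∑ i, #(bipartiteAbove (fun i j => i ∉ M j) univ i)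
          rw [sum_card_bipartiteAbove_eq_sum_card_bipartiteBelow
            (s := univ) (t := univ) (fun i j => i ∉ M j)]
          have := card_nsmul_le_sum univ
            (fun j => #(bipartiteBelow (fun i j => i ∉ M j) univ j)) (n - t) fun j _ => by
              have h1 : bipartiteBelow (fun i j => i ∉ M j) univ j = (M j)ᶜ := by
                ext; simp
              rw [h1, card_compl, Fintype.card_fin]
              have := hM j
              omega
          simpa using this
      _ = ∑ i, (#(B i) : ℕ∞) := by push_cast; rfl
      _ ≤ _ := sum_le_sum fun i _ => hf i (fun r => y r i) (B i) fun j hj r =>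
          hMy j i (mem_filter.1 hj).2 r
  · intro h k f
    have hc (i : Fin n) : ∃ c : ℕ, (c : ℕ∞) = min (W i).ambiguity m :=
      ENat.ne_top_iff_exists.1 ((min_le_right _ _).trans_lt (ENat.natCast_lt_top m)).ne
    choose c hc using hc
    have hcm (i) : c i ≤ m := Nat.cast_le.1 ((hc i).trans_le (min_le_right _ _))
    simp_rw [← hc] at h
    rw [← Nat.cast_sum, Nat.cast_le] at h
    obtain ⟨B, hB, hcov⟩ := exists_finset_fin_cover c hcm h
    have hadj (i) : (W i).Adjacent (c i) :=
      ((W i).isAmbiguity_ambiguity.adjacent _).2 ((hc i).trans_le (min_le_left _ _))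
    -- `B` does not depend on the round, so neither do the malicious sets: for word `j`, the at most
    -- `t` channels whose `B i` misses `j`.
    choose y hy using fun r i => (hadj i).exists_common_output (B i) (hB i) fun j => f j r i
    refine ⟨y, fun j => ⟨(univ.filter fun i => j ∈ B i)ᶜ, ?_, fun i hi r => hy r i j ?_⟩⟩
    · rw [card_compl, Fintype.card_fin]
      have := hcov j
      omega
    · simpa using hi

end ZeroErrorChannel

theorem mainTheorem4 {n : ℕ} {X : Fin n → Type*} {Y : Fin n → Type*}
    [∀ i, Finite (X i)] [∀ i, Nonempty (X i)]
    (W : ∀ i, ZeroErrorChannel (X i) (Y i)) (t : ℕ) (a : ℕ∞) :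
    ZeroErrorChannel.IsAmbiguityOfRounds (ZeroErrorChannel.parallel W t) a ↔
      a = ⨅ G : {G : Finset (Fin n) // t < #G},
          ⌊((∑ i ∈ G.1, (W i).ambiguity : ℕ∞) : ℝ≥0∞) / ((#G.1 - t : ℕ) : ℝ≥0∞)⌋ₑ := by
  have key (m : ℕ) : (∀ k, (ZeroErrorChannel.parallel W t k).Adjacent m) ↔
      (m : ℕ∞) ≤ ⨅ G : {G : Finset (Fin n) // t < #G},
        ⌊((∑ i ∈ G.1, (W i).ambiguity : ℕ∞) : ℝ≥0∞) / ((#G.1 - t : ℕ) : ℝ≥0∞)⌋ₑ := by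
    rw [ZeroErrorChannel.parallel_adjacent_iff, mul_sub_le_sum_min_iff, le_iInf_iff, Subtype.forall]
    exact forall₂_congr fun G hG =>
      (ENat.natCast_le_floor_div_iff (Nat.sub_ne_zero_of_lt hG)).symm
  rw [ZeroErrorChannel.isAmbiguityOfRounds_iff]
  simp_rw [key]
  exact ⟨fun h => ENat.eq_of_forall_natCast_le_iff fun m => (h m).symm, fun h m => by rw [h]⟩
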